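/- Let $H_0, H_1, \dots \in \mathbb{C}[x]$ be the classical Hermite polynomials ($H_0 = 1$, $H_{n+1} = 2xH_n - H_n'$), and let $\operatorname{Wr}$ denote the Wronskian determinant with respect to $x$. Let $\lambda_1 \le \dots \le \lambda_\ell$ be positive integers, put $N = \lambda_1 + \dots + \lambda_\ell$ and $k_i = \lambda_i + i - 1$, and let $$\eta = \operatorname{Wr}(H_{k_1}, \dots, H_{k_\ell}).$$ For $n$ in $\mathcal{I} = \{ n \in \mathbb{N}_0 : n \ge N - \ell,\ n + \ell - N \notin \{k_1, \dots, k_\ell\} \}$ let $$\hat h_n = \operatorname{Wr}(H_{k_1}, \dots, H_{k_\ell}, H_{n + \ell - N})$$ be the exceptional Hermite polynomials, let $\mathcal{U} \subset \mathbb{C}[x]$ be the complex linear span of $\{\hat h_n : n \in \mathcal{I}\}$, and let $\mathcal{S}$ be the stabilizer ring, that is, the subring of all $f \in \mathbb{C}[x]$ such that $f \hat h_n \in \mathcal{U}$ for all $n \in \mathcal{I}$. Then: 1. If $f \in \mathbb{C}[x]$ and $f'$ is divisible by $\eta$, then $f \in \mathcal{S}$. 2. Conversely, if $\eta$ has only simple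 roots, then $\eta$ divides $f'$ for every $f \in \mathcal{S}$. 3. If $p \in \mathcal{U}$, then $\eta$ divides $2\eta'(xp - p') + \eta'' p$. 4. If $\eta$ has only simple roots, then a polynomial $p \in \mathbb{C}[x]$ belongs to $\mathcal{U}$ if and only if $\eta$ divides $2\eta'(xp - p') + \eta'' p$. -/

import Mathlib

open Polynomial

noncomputable section

namespace ExceptionalHermite

/-- The classical (physicists') Hermite polynomials `H n`, with leading coefficient `2 ^ n`:
`H 0 = 1` and `H (n + 1) = 2 x H n - (H n)'`, i.e. the polynomials given by
`(-1) ^ n * exp (x ^ 2) * (d / dx) ^ n exp (- x ^ 2)`. -/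
def H : ℕ → ℂ[X]
  | 0 => 1
  | n + 1 => 2 * X * H n - derivative (H n)

/-- The Wronskian determinant of the polynomials `f 0, …, f (m - 1)`. -/
def wr {m : ℕ} (f : Fin m → ℂ[X]) : ℂ[X] :=
  (Matrix.of fun i j : Fin m => derivative^[(i : ℕ)] (f j)).det

variable {ℓ : ℕ}

/-- The strictly increasing sequence attached to a partition `lam 0 ≤ lam 1 ≤ …`;
indices start at `0` here, so that `k i = lam i + i`. -/
def kseq (lam : Fin ℓ → ℕ) (i : Fin ℓ) : ℕ := lam i + (i : ℕ)

/-- The integer `N` of which `lam` is a partition. -/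
def size (lam : Fin ℓ → ℕ) : ℕ := ∑ i, lam i

/-- The Hermite Wronskian `η`. -/
def eta (lam : Fin ℓ → ℕ) : ℂ[X] := wr fun i => H (kseq lam i)

/-- The operator `A y = Wr (H k₁, …, H k_ℓ, y)`, acting on polynomials. -/
def opA (lam : Fin ℓ → ℕ) (y : ℂ[X]) : ℂ[X] :=
  wr (Fin.snoc (α := fun _ => ℂ[X]) (fun i => H (kseq lam i)) y)

/-- The degree set of the exceptional Hermite polynomials:
all `n ≥ N - ℓ` such that `n + ℓ - N` is none of the `k i`. -/
def degreeSet (lam : Fin ℓ → ℕ) : Set ℕ :=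
  {n | size lam ≤ n + ℓ ∧ ∀ i, n + ℓ - size lam ≠ kseq lam i}

/-- The exceptional Hermite polynomial of index `n`; it is used only for `n` in `degreeSet lam`,
where the subtraction is not truncated. -/
def exceptionalH (lam : Fin ℓ → ℕ) (n : ℕ) : ℂ[X] := opA lam (H (n + ℓ - size lam))

/-- The space `U` of finite linear combinations of exceptional Hermite polynomials. -/
def spaceU (lam : Fin ℓ → ℕ) : Submodule ℂ ℂ[X] :=
  Submodule.span ℂ (exceptionalH lam '' degreeSet lam)

theorem mul_mem_spaceU {lam : Fin ℓ → ℕ} {f u : ℂ[X]}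
    (hf : ∀ n ∈ degreeSet lam, f * exceptionalH lam n ∈ spaceU lam) (hu : u ∈ spaceU lam) :
    f * u ∈ spaceU lam := by
  have h : spaceU lam ≤ (spaceU lam).comap (LinearMap.mulLeft ℂ f) := by
    refine Submodule.span_le.2 ?_
    rintro _ ⟨n, hn, rfl⟩
    exact hf n hn
  exact h hu

/-- The stabilizer ring `S`: all polynomials `f` such that `f` times each exceptional Hermite
polynomial lies in `U`. -/
def stabilizerRing (lam : Fin ℓ → ℕ) : Subalgebra ℂ ℂ[X] where
  carrier := {f | ∀ n ∈ degreeSet lam, f * exceptionalH lam n ∈ spaceU lam}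
  mul_mem' := by
    intro a b ha hb n hn
    rw [mul_assoc]
    exact mul_mem_spaceU ha (hb n hn)
  add_mem' := by
    intro a b ha hb n hn
    rw [add_mul]
    exact (spaceU lam).add_mem (ha n hn) (hb n hn)
  algebraMap_mem' := by
    intro c n hn
    rw [← Algebra.smul_def]
    exact (spaceU lam).smul_mem c (Submodule.subset_span ⟨n, hn, rfl⟩)

/-- All complex roots of `q` are simple. -/
def OnlySimpleRoots (q : ℂ[X]) : Prop := ∀ z : ℂ, q.IsRoot z → q.rootMultiplicity z = 1

end ExceptionalHermite

end

/-!
# The stabilizer ring of exceptional Hermite polynomials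

Let `F` be the tuple of the `H (k i)`, let `η = Wr (F)`, and let `A y = Wr (F, y)`, a differential
operator of order `ℓ` with leading coefficients `η, -η'`. Since the Hermite polynomials span `ℂ[X]`
and `A` annihilates `F`, the space `U` is the range of `A` on `ℂ[X]` (`mem_spaceU_iff`).

* If `η ∣ f'`, Cramer's rule gives polynomials `P k` with `η y⁽ʲ⁾ = ∑ P k (F k)⁽ʲ⁾` for `j < ℓ`. With
  `c k` an antiderivative of `-(f' / η) P k`, the polynomial `z = f y + ∑ c k F k` satisfies
  `z⁽ʲ⁾ = f y⁽ʲ⁾ + ∑ c k (F k)⁽ʲ⁾` for `j ≤ ℓ`, hence `A z = f A y`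
  (`mul_wrSnoc_mem_range`). The same variation of constants shows `η² ℂ[X] ⊆ U`
  (`sq_mul_mem_range`).
* With `T y = y'' - 2 x y'`, the operator
  `η T A - 2 η' ∂ A + (η'' + 2 x η' - 2 ℓ η) A - η A T` has order less than `ℓ` and annihilates the
  eigenfunctions `F k` of `T`, so it vanishes if `η ≠ 0` (`wrSnoc_intertwining`). Reading this modulo
  `η` gives the divisibility condition on the members of `U`.
* If the zeros of `η` are simple, the coefficient `-η'` of `A` shows that `U` has no common zero at
  them (`exists_wrSnoc_eval_ne_zero`). The condition for `f p` minus `f` times the condition for `p`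
  is `η ∣ 2 η' f' p`, so `η ∣ f'` for all `f` in the stabilizer ring. Moreover the condition is one
  linear relation between `p(z)` and `p'(z)` at each zero `z`, so that `p` agrees with some member of
  `U` modulo `(x - z)²`. Since `η² ℂ[X] ⊆ U` and `U` is stable under polynomials `f` with `η ∣ f'`,
  which include lifts of the idempotents of `ℂ[x] / η²`, this local agreement implies `p ∈ U`
  (`mem_spaceU_of_eta_dvd`). No count of degrees is needed.
-/

namespace ExceptionalHermite

/-! ### Classical Hermite polynomials -/

theorem derivative_H_succ (n : ℕ) : derivative (H (n + 1)) = 2 * (n + 1) * H n := by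
  induction n with
  | zero => simp [H]
  | succ n ih =>
    have h : H (n + 2) = 2 * X * H (n + 1) - derivative (H (n + 1)) := rfl
    have h1 : H (n + 1) = 2 * X * H n - derivative (H n) := rfl
    rw [h, ih]
    simp only [derivative_sub, derivative_mul, ih, derivative_X, derivative_ofNat,
      derivative_add, derivative_natCast, derivative_one, Nat.cast_add, Nat.cast_one]
    linear_combination -2 * ((n : ℂ[X]) + 1) * h1

/-- Hermite's differential equation. -/
theorem hermite_equation (n : ℕ) :
    derivative (derivative (H n)) - 2 * X * derivative (H n) = -(2 * (n : ℂ[X]) * H n) := by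
  cases n with
  | zero => simp [H]
  | succ n =>
    have h1 : H (n + 1) = 2 * X * H n - derivative (H n) := rfl
    rw [derivative_H_succ]
    simp only [derivative_mul, derivative_ofNat,
      derivative_add, derivative_natCast, derivative_one, Nat.cast_add, Nat.cast_one, zero_mul,
      mul_zero, add_zero, zero_add]
    linear_combination 2 * ((n : ℂ[X]) + 1) * h1

/-- The three-term recurrence `2 x H n = H (n + 1) + 2 n H (n - 1)`. -/
theorem X_mul_H_mem_span (n : ℕ) : X * H n ∈ Submodule.span ℂ (Set.range H) := by
  have mem (m : ℕ) : H m ∈ Submodule.span ℂ (Set.range H) := Submodule.subset_span ⟨m, rfl⟩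
  have key : X * H n = (1 / 2 : ℂ) • (H (n + 1) + derivative (H n)) := by
    have h1 : H (n + 1) = 2 * X * H n - derivative (H n) := rfl
    rw [h1, sub_add_cancel, smul_eq_C_mul, ← mul_assoc, ← mul_assoc,
      ← C_ofNat, ← C_mul]
    norm_num
  rw [key]
  refine Submodule.smul_mem _ _ (Submodule.add_mem _ (mem _) ?_)
  cases n with
  | zero => simp [H]
  | succ n =>
    rw [derivative_H_succ, show 2 * ((n : ℂ[X]) + 1) * H n = (2 * ((n : ℂ) + 1)) • H n by
      simp [smul_eq_C_mul, C_ofNat]]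
    exact Submodule.smul_mem _ _ (mem _)

theorem span_range_H : Submodule.span ℂ (Set.range H) = ⊤ := by
  have hX (q : ℂ[X]) (hq : q ∈ Submodule.span ℂ (Set.range H)) :
      X * q ∈ Submodule.span ℂ (Set.range H) := by
    have h : Submodule.span ℂ (Set.range H) ≤
        (Submodule.span ℂ (Set.range H)).comap (LinearMap.mulLeft ℂ X) := by
      refine Submodule.span_le.2 ?_
      rintro _ ⟨n, rfl⟩
      exact X_mul_H_mem_span n
    exact h hq
  have hpow (n : ℕ) : (X : ℂ[X]) ^ n ∈ Submodule.span ℂ (Set.range H) := by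
    induction n with
    | zero => exact Submodule.subset_span ⟨0, by simp [H]⟩
    | succ n ih => rw [pow_succ']; exact hX _ ih
  refine eq_top_iff.2 fun p _ => ?_
  rw [p.as_sum_range_C_mul_X_pow]
  refine Submodule.sum_mem _ fun i _ => ?_
  rw [← smul_eq_C_mul]
  exact Submodule.smul_mem _ _ (hpow i)

/-! ### Wronskians as differential operators -/

/-- The derivative of a determinant, taken column by column. -/
theorem derivative_det {n : Type*} [Fintype n] [DecidableEq n] (M : Matrix n n ℂ[X]) :
    derivative M.det = ∑ j, (M.updateCol j fun i => derivative (M i j)).det := by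
  simp only [Matrix.det_apply', derivative_sum, derivative_mul, derivative_intCast, zero_mul,
    zero_add, derivative_prod_finset, Finset.mul_sum]
  rw [Finset.sum_comm]
  refine Finset.sum_congr rfl fun j _ => Finset.sum_congr rfl fun σ _ => ?_
  rw [← Finset.mul_prod_erase _ _ (Finset.mem_univ j), mul_comm (Finset.prod _ _)]
  congr 2
  · simp
  · refine Finset.prod_congr rfl fun i hi => ?_
    rw [Matrix.updateCol_ne (Finset.ne_of_mem_erase hi)]

/-- The operator `y ↦ Wr (F 0, …, F (ℓ - 1), y)`. -/
noncomputable def wrSnoc {ℓ : ℕ} (F : Fin ℓ → ℂ[X]) (y : ℂ[X]) : ℂ[X] :=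
  wr (Fin.snoc (α := fun _ => ℂ[X]) F y)

/-- The coefficient of the `i`-th derivative in the differential operator `wrSnoc F`, that is, the
cofactor at row `i` of the last column. -/
noncomputable def wrCoeff {ℓ : ℕ} (F : Fin ℓ → ℂ[X]) (i : Fin (ℓ + 1)) : ℂ[X] :=
  (-1) ^ ((i : ℕ) + ℓ) *
    (Matrix.of fun r c : Fin ℓ => derivative^[(i.succAbove r : ℕ)] (F c)).det

section

variable {ℓ : ℕ} (F : Fin ℓ → ℂ[X])

theorem wrSnoc_eq_sum (y : ℂ[X]) :
    wrSnoc F y = ∑ i : Fin (ℓ + 1), wrCoeff F i * derivative^[(i : ℕ)] y := by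
  rw [wrSnoc, wr, Matrix.det_succ_column _ (Fin.last ℓ)]
  refine Finset.sum_congr rfl fun i _ => ?_
  rw [wrCoeff, mul_right_comm]
  congr 2
  · congr 1
    refine Matrix.ext fun r c => ?_
    simp
  · simp

theorem wrSnoc_self (k : Fin ℓ) : wrSnoc F (F k) = 0 := by
  refine Matrix.det_zero_of_column_eq (Fin.castSucc_lt_last k).ne fun i => ?_
  simp

theorem wrCoeff_last : wrCoeff F (Fin.last ℓ) = wr F := by
  simp [wrCoeff, wr, ← two_mul]

theorem wrSnoc_add (y z : ℂ[X]) : wrSnoc F (y + z) = wrSnoc F y + wrSnoc F z := by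
  simp only [wrSnoc_eq_sum, iterate_map_add, mul_add, Finset.sum_add_distrib]

theorem wrSnoc_smul (c : ℂ) (y : ℂ[X]) : wrSnoc F (c • y) = c • wrSnoc F y := by
  simp only [wrSnoc_eq_sum, iterate_derivative_smul, mul_smul_comm, Finset.smul_sum]

/-- If the jet of `z` up to order `ℓ` is a combination of the jets of `y` and of the `F k`, up to an
error `g` in the top entry, then the values of `wrSnoc F` are related by the same combination, in
which the `F k` drop out. -/
theorem wrSnoc_eq_mul_add {z y f g : ℂ[X]} (c : Fin ℓ → ℂ[X])
    (h : ∀ j < ℓ, derivative^[j] z =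
      f * derivative^[j] y + ∑ k, c k * derivative^[j] (F k))
    (h_top : derivative^[ℓ] z =
      f * derivative^[ℓ] y + ∑ k, c k * derivative^[ℓ] (F k) + g) :
    wrSnoc F z = f * wrSnoc F y + wr F * g := by
  have hsum : ∑ k, c k * wrSnoc F (F k) = 0 := by simp [wrSnoc_self]
  rw [← add_zero (f * _), ← hsum]
  simp only [wrSnoc_eq_sum]
  rw [Fin.sum_univ_castSucc]
  simp only [Fin.val_castSucc, Fin.val_last, h_top, h _ (Fin.is_lt _), Fin.sum_univ_castSucc,
    wrCoeff_last, mul_add, Finset.sum_add_distrib, Finset.mul_sum]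
  rw [Finset.sum_comm]
  simp only [mul_left_comm (wrCoeff _ _), mul_left_comm (wr F)]
  ring

/-- Cramer's rule for the Wronskian matrix of `F`. -/
theorem sum_cramer_mul (b : Fin ℓ → ℂ[X]) (j : Fin ℓ) :
    ∑ k, Matrix.cramer (Matrix.of fun i j : Fin ℓ => derivative^[(i : ℕ)] (F j)) b k *
      derivative^[(j : ℕ)] (F k) = wr F * b j := by
  have h := congrFun (Matrix.mulVec_cramer
    (Matrix.of fun i j : Fin ℓ => derivative^[(i : ℕ)] (F j)) b) j
  simp only [Matrix.mulVec, dotProduct, Matrix.of_apply, Pi.smul_apply, smul_eq_mul] at h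
  rw [wr, ← h]
  exact Finset.sum_congr rfl fun _ _ => mul_comm _ _

end

/-- Only the last row of a Wronskian needs to be differentiated, since differentiating any other row
produces two equal rows. -/
theorem derivative_wr {m : ℕ} (F : Fin (m + 1) → ℂ[X]) :
    derivative (wr F) =
      (Matrix.of fun r c : Fin (m + 1) =>
        derivative^[((Fin.last m).castSucc.succAbove r : ℕ)] (F c)).det := by
  rw [wr, ← Matrix.det_transpose, derivative_det, Fin.sum_univ_castSucc, Finset.sum_eq_zero,
    zero_add, ← Matrix.det_transpose]
  · congr 1
    refine Matrix.ext fun c r => ?_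
    rcases Fin.eq_castSucc_or_eq_last c with ⟨c, rfl⟩ | rfl
    · simp [Fin.succAbove_of_castSucc_lt, Fin.castSucc_lt_last, (Fin.castSucc_lt_last c).ne]
    · simp [← Function.iterate_succ_apply' (f := derivative)]
  · intro j _
    refine Matrix.det_zero_of_column_eq (Fin.castSucc_lt_succ (i := j)).ne fun r => ?_
    rw [Matrix.updateCol_self, Matrix.updateCol_ne (Fin.castSucc_lt_succ (i := j)).ne']
    simp only [Matrix.transpose_apply, Matrix.of_apply, Fin.val_castSucc, Fin.val_succ,
      Function.iterate_succ_apply']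

theorem wrCoeff_penultimate {m : ℕ} (F : Fin (m + 1) → ℂ[X]) :
    wrCoeff F (Fin.last m).castSucc = -derivative (wr F) := by
  have hsign : (-1 : ℂ[X]) ^ (m + (m + 1)) = -1 := Odd.neg_one_pow ⟨m, by ring⟩
  rw [derivative_wr, wrCoeff, Fin.val_castSucc, Fin.val_last, hsign, neg_one_mul]

/-- At a simple zero of `Wr (F)` the operator `wrSnoc F` has a nonzero coefficient, namely
`-Wr (F)'`, so that not all its values vanish there. -/
theorem exists_wrSnoc_eval_ne_zero {ℓ : ℕ} {F : Fin ℓ → ℂ[X]} {z : ℂ} (hz : (wr F).eval z = 0)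
    (hz' : (derivative (wr F)).eval z ≠ 0) : ∃ y, (wrSnoc F y).eval z ≠ 0 := by
  obtain _ | m := ℓ
  · simp [wr] at hz
  refine ⟨(X - C z) ^ m, ?_⟩
  rw [wrSnoc_eq_sum, Fin.sum_univ_castSucc, Fin.sum_univ_castSucc, wrCoeff_last,
    wrCoeff_penultimate, eval_add, eval_add, eval_finsetSum, Finset.sum_eq_zero]
  · simp [hz, hz', iterate_derivative_X_sub_pow_self, Nat.factorial_ne_zero]
  · intro j _
    simp [iterate_derivative_X_sub_pow, Nat.sub_ne_zero_of_lt j.2]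

/-! ### Intertwining with the Hermite operator -/

/-- `P` is a linear differential operator of order less than `n` with polynomial coefficients. -/
def OrderLT (n : ℕ) (P : ℂ[X] → ℂ[X]) : Prop :=
  ∃ e : Fin n → ℂ[X], ∀ y, P y = ∑ j, e j * derivative^[(j : ℕ)] y

namespace OrderLT

variable {n : ℕ} {P Q : ℂ[X] → ℂ[X]}

theorem add (hP : OrderLT n P) (hQ : OrderLT n Q) : OrderLT n fun y => P y + Q y := by
  obtain ⟨e, he⟩ := hP
  obtain ⟨d, hd⟩ := hQ
  exact ⟨fun j => e j + d j, fun y => by simp only [he, hd, add_mul, Finset.sum_add_distrib]⟩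

theorem mul_left (hP : OrderLT n P) (a : ℂ[X]) : OrderLT n fun y => a * P y := by
  obtain ⟨e, he⟩ := hP
  exact ⟨fun j => a * e j, fun y => by simp only [he, mul_assoc, Finset.mul_sum]⟩

theorem mul_iterate_derivative (a : ℂ[X]) {j : ℕ} (hj : j < n) :
    OrderLT n fun y => a * derivative^[j] y :=
  ⟨Pi.single ⟨j, hj⟩ a, fun y => by
    rw [Finset.sum_eq_single (⟨j, hj⟩ : Fin n)] <;> simp +contextual⟩

theorem sum {ι : Type*} [Fintype ι] {P : ι → ℂ[X] → ℂ[X]} (hP : ∀ i, OrderLT n (P i)) :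
    OrderLT n fun y => ∑ i, P i y := by
  choose e he using hP
  refine ⟨fun j => ∑ i, e i j, fun y => ?_⟩
  simp only [he, Finset.sum_mul]
  exact Finset.sum_comm

/-- An operator of order less than the number of its solutions vanishes if the Wronskian of
these solutions does not. -/
theorem eq_zero (hP : OrderLT n P) {F : Fin n → ℂ[X]} (hF : wr F ≠ 0) (h : ∀ k, P (F k) = 0)
    (y : ℂ[X]) : P y = 0 := by
  obtain ⟨e, he⟩ := hP
  have h0 : e = 0 := by
    refine Matrix.eq_zero_of_vecMul_eq_zero hF (funext fun k => ?_)
    simpa [Matrix.vecMul, dotProduct, he] using h k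
  simp [he, h0]

end OrderLT

/-- The Hermite operator `y ↦ y'' - 2 x y'`. -/
noncomputable def hermiteOp (y : ℂ[X]) : ℂ[X] :=
  derivative (derivative y) - 2 * X * derivative y

theorem iterate_derivative_hermiteOp (j : ℕ) (y : ℂ[X]) :
    derivative^[j] (hermiteOp y) =
      derivative^[j + 2] y - 2 * X * derivative^[j + 1] y - 2 * (j : ℂ[X]) * derivative^[j] y := by
  induction j with
  | zero => simp [hermiteOp]
  | succ j ih =>
    rw [Function.iterate_succ_apply', ih]
    simp only [derivative_sub, derivative_mul, derivative_X, derivative_ofNat, derivative_natCast,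
      ← Function.iterate_succ_apply' (f := derivative), Nat.succ_eq_add_one, Nat.cast_add,
      Nat.cast_one]
    ring

/-- The intertwining relation between `wrSnoc F` and the Hermite operator for a tuple `F` of
eigenfunctions. The left-hand side is an operator of order at most `m` in `y` which annihilates the
`m + 1` functions `F k`. -/
theorem wrSnoc_intertwining {m : ℕ} {F : Fin (m + 1) → ℂ[X]} {μ : Fin (m + 1) → ℂ}
    (hF : ∀ k, hermiteOp (F k) = C (μ k) * F k) (h0 : wr F ≠ 0) (y : ℂ[X]) :
    wr F * hermiteOp (wrSnoc F y) - 2 * derivative (wr F) * derivative (wrSnoc F y) +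
        (derivative (derivative (wr F)) + 2 * X * derivative (wr F)
          - 2 * ((m : ℂ[X]) + 1) * wr F) * wrSnoc F y -
      wr F * wrSnoc F (hermiteOp y) = 0 := by
  set η := wr F
  set r : Fin m → ℂ[X] := fun j => wrCoeff F j.castSucc.castSucc
  have hA (y : ℂ[X]) : wrSnoc F y = η * derivative^[m + 1] y - derivative η * derivative^[m] y +
      ∑ j : Fin m, r j * derivative^[(j : ℕ)] y := by
    rw [wrSnoc_eq_sum, Fin.sum_univ_castSucc, Fin.sum_univ_castSucc, wrCoeff_last,
      wrCoeff_penultimate]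
    simp only [Fin.val_castSucc, Fin.val_last]
    ring
  refine OrderLT.eq_zero (n := m + 1) (F := F) (P := fun y => η * hermiteOp (wrSnoc F y) -
    2 * derivative η * derivative (wrSnoc F y) + (derivative (derivative η) + 2 * X * derivative η
      - 2 * ((m : ℂ[X]) + 1) * η) * wrSnoc F y - η * wrSnoc F (hermiteOp y)) ?_ h0 ?_ y
  · -- the contributions of the derivatives of order `m + 1` and higher cancel
    obtain ⟨b, hb⟩ : ∃ b : ℂ[X], b = derivative (derivative η) + 2 * X * derivative η -
        2 * ((m : ℂ[X]) + 1) * η := ⟨_, rfl⟩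
    obtain ⟨a, ha⟩ : ∃ a : ℂ[X], a = η * (2 * X * derivative (derivative η) -
        derivative (derivative (derivative η))) + 2 * derivative η * derivative (derivative η) -
        b * derivative η - 2 * (m : ℂ[X]) * η * derivative η := ⟨_, rfl⟩
    obtain ⟨u, hu⟩ : ∃ u : Fin m → ℂ[X], ∀ j, u j = η * (derivative (derivative (r j)) -
        2 * X * derivative (r j) + 2 * ((j : ℕ) : ℂ[X]) * r j) -
        2 * derivative η * derivative (r j) + b * r j := ⟨_, fun _ => rfl⟩
    obtain ⟨v, hv⟩ : ∃ v : Fin m → ℂ[X], ∀ j, v j = 2 * η * derivative (r j) -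
        2 * derivative η * r j := ⟨_, fun _ => rfl⟩
    have hsum (y : ℂ[X]) :
        ∑ j : Fin m, (u j * derivative^[(j : ℕ)] y + v j * derivative^[(j : ℕ) + 1] y) =
        η * hermiteOp (∑ j : Fin m, r j * derivative^[(j : ℕ)] y) -
          2 * derivative η * derivative (∑ j : Fin m, r j * derivative^[(j : ℕ)] y) +
          b * ∑ j : Fin m, r j * derivative^[(j : ℕ)] y -
          η * ∑ j : Fin m, r j * derivative^[(j : ℕ)] (hermiteOp y) := by
      simp only [iterate_derivative_hermiteOp]
      simp only [hermiteOp, derivative_sum, mul_sub, Finset.mul_sum, ← Finset.sum_add_distrib,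
        ← Finset.sum_sub_distrib, derivative_mul, derivative_add,
        ← Function.iterate_succ_apply' (f := derivative), Nat.succ_eq_add_one]
      exact Finset.sum_congr rfl fun j _ => by rw [hu, hv]; ring
    have hE := (OrderLT.mul_iterate_derivative a m.lt_succ_self).add <|
      OrderLT.sum fun j : Fin m =>
        (OrderLT.mul_iterate_derivative (u j) (j.2.trans m.lt_succ_self)).add
        (OrderLT.mul_iterate_derivative (v j) (Nat.succ_lt_succ j.2))
    refine (congrArg (OrderLT (m + 1)) (funext fun y => ?_)).mp hE
    simp only [Nat.succ_eq_add_one]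
    rw [hsum, hA, hA]
    generalize (∑ j : Fin m, r j * derivative^[(j : ℕ)] y) = R
    generalize (∑ j : Fin m, r j * derivative^[(j : ℕ)] (hermiteOp y)) = R'
    simp only [iterate_derivative_hermiteOp]
    simp only [hermiteOp, derivative_mul, derivative_add, derivative_sub,
      ← Function.iterate_succ_apply' (f := derivative), Nat.succ_eq_add_one, ha, hb]
    push_cast
    ring
  · intro k
    simp only [hF, ← smul_eq_C_mul, wrSnoc_smul, wrSnoc_self]
    simp [hermiteOp]

theorem wr_dvd_of_mem_range {ℓ : ℕ} {F : Fin ℓ → ℂ[X]} {μ : Fin ℓ → ℂ}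
    (hF : ∀ k, hermiteOp (F k) = C (μ k) * F k) (y : ℂ[X]) :
    wr F ∣ 2 * derivative (wr F) * (X * wrSnoc F y - derivative (wrSnoc F y)) +
      derivative (derivative (wr F)) * wrSnoc F y := by
  obtain _ | m := ℓ
  · simp [wr]
  by_cases h0 : wr F = 0
  · simp [h0]
  refine ⟨2 * ((m : ℂ[X]) + 1) * wrSnoc F y + wrSnoc F (hermiteOp y) -
    hermiteOp (wrSnoc F y), ?_⟩
  linear_combination wrSnoc_intertwining hF h0 y

/-! ### The range of the Wronskian operator -/

theorem exists_derivative_eq (p : ℂ[X]) : ∃ q : ℂ[X], derivative q = p := by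
  induction p using Polynomial.induction_on' with
  | add p q hp hq =>
    obtain ⟨a, rfl⟩ := hp
    obtain ⟨b, rfl⟩ := hq
    exact ⟨a + b, derivative_add⟩
  | monomial n c =>
    refine ⟨monomial (n + 1) (c / (n + 1)), ?_⟩
    have : (n : ℂ) + 1 ≠ 0 := Nat.cast_add_one_ne_zero n
    simp [this]

/-- If `η = Wr (F)` divides `f'`, multiplication by `f` preserves the range of `wrSnoc F`.
Writing `y` and its derivatives of order less than `ℓ` as `∑ V k * F k` by Cramer's rule, the
products `f' * V k` are polynomials, and subtracting their antiderivatives from the coefficients of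
`f * y` gives the preimage of `f * wrSnoc F y`. -/
theorem mul_wrSnoc_mem_range {ℓ : ℕ} {F : Fin ℓ → ℂ[X]} {f : ℂ[X]} (hf : wr F ∣ derivative f)
    (y : ℂ[X]) : ∃ z, wrSnoc F z = f * wrSnoc F y := by
  obtain ⟨g, hg⟩ := hf
  set P : Fin ℓ → ℂ[X] := Matrix.cramer (Matrix.of fun i j : Fin ℓ => derivative^[(i : ℕ)] (F j))
    (fun i => derivative^[(i : ℕ)] y)
  have hPsum (j : ℕ) (hj : j < ℓ) :
      ∑ k, P k * derivative^[j] (F k) = wr F * derivative^[j] y :=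
    sum_cramer_mul F (fun i => derivative^[(i : ℕ)] y) ⟨j, hj⟩
  choose c hc using fun k => exists_derivative_eq (-(g * P k))
  have key (j : ℕ) (hj : j ≤ ℓ) : derivative^[j] (f * y + ∑ k, c k * F k) =
      f * derivative^[j] y + ∑ k, c k * derivative^[j] (F k) := by
    induction j with
    | zero => simp
    | succ j ih =>
      have h : ∑ k, g * P k * derivative^[j] (F k) = g * (wr F * derivative^[j] y) := by
        rw [← hPsum j hj, Finset.mul_sum]
        simp only [mul_assoc]
      rw [Function.iterate_succ_apply', ih (Nat.le_of_succ_le hj)]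
      simp only [derivative_add, derivative_mul, derivative_sum, hc, hg, neg_mul,
        Finset.sum_add_distrib, Finset.sum_neg_distrib, h, Function.iterate_succ_apply']
      ring
  refine ⟨f * y + ∑ k, c k * F k, ?_⟩
  rw [wrSnoc_eq_mul_add F (g := 0) c (fun j hj => key j hj.le) (by simpa using key ℓ le_rfl)]
  simp

/-- Variation of constants: all multiples of `Wr (F) ^ 2` lie in the range of `wrSnoc F`. -/
theorem sq_mul_mem_range {ℓ : ℕ} (F : Fin ℓ → ℂ[X]) (q : ℂ[X]) :
    ∃ z, wrSnoc F z = wr F ^ 2 * q := by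
  obtain _ | m := ℓ
  · exact ⟨q, by simp [wrSnoc_eq_sum, wrCoeff, wr]⟩
  set P : Fin (m + 1) → ℂ[X] :=
    Matrix.cramer (Matrix.of fun i j : Fin (m + 1) => derivative^[(i : ℕ)] (F j))
      (Pi.single (Fin.last m) q)
  have hPsum (j : Fin (m + 1)) : ∑ k, P k * derivative^[(j : ℕ)] (F k) =
      wr F * (Pi.single (Fin.last m) q : Fin (m + 1) → ℂ[X]) j :=
    sum_cramer_mul F _ j
  choose c hc using fun k => exists_derivative_eq (P k)
  have key (j : ℕ) (hj : j ≤ m) : derivative^[j] (∑ k, c k * F k) =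
      ∑ k, c k * derivative^[j] (F k) := by
    induction j with
    | zero => simp
    | succ j ih =>
      have h := hPsum ⟨j, by omega⟩
      rw [Pi.single_eq_of_ne (by simp [Fin.ext_iff]; omega), mul_zero] at h
      rw [Function.iterate_succ_apply', ih (Nat.le_of_succ_le hj)]
      simp only [derivative_mul, derivative_sum, hc, Finset.sum_add_distrib,
        Function.iterate_succ_apply'] at h ⊢
      rw [h, zero_add]
  have h_top : derivative^[m + 1] (∑ k, c k * F k) =
      ∑ k, c k * derivative^[m + 1] (F k) + wr F * q := by
    have h := hPsum (Fin.last m)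
    rw [Pi.single_eq_same, Fin.val_last] at h
    rw [Function.iterate_succ_apply', key m le_rfl]
    simp only [derivative_mul, derivative_sum, hc, Finset.sum_add_distrib,
        Function.iterate_succ_apply'] at h ⊢
    rw [h, add_comm]
  refine ⟨∑ k, c k * F k, ?_⟩
  rw [wrSnoc_eq_mul_add F (y := 0) (f := 0) (g := wr F * q) c
    (fun j hj => by simpa using key j (Nat.le_of_lt_succ hj)) (by simpa using h_top)]
  ring

/-! ### Polynomials with only simple roots -/

theorem OnlySimpleRoots.ne_zero {q : ℂ[X]} (h : OnlySimpleRoots q) : q ≠ 0 := by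
  rintro rfl
  simpa using h 0 (by simp)

theorem OnlySimpleRoots.eval_derivative_ne_zero {q : ℂ[X]} (h : OnlySimpleRoots q) {z : ℂ}
    (hz : q.eval z = 0) : (derivative q).eval z ≠ 0 := fun hd => by
  have := (one_lt_rootMultiplicity_iff_isRoot h.ne_zero).2 ⟨hz, hd⟩
  exact this.ne' (h z hz)

theorem OnlySimpleRoots.dvd {q f : ℂ[X]} (h : OnlySimpleRoots q)
    (hf : ∀ z, q.eval z = 0 → f.eval z = 0) : q ∣ f := by
  classical
  by_cases hf0 : f = 0
  · simp [hf0]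
  rw [IsAlgClosed.dvd_iff_roots_le_roots h.ne_zero hf0, Multiset.le_iff_count]
  intro z
  by_cases hz : q.eval z = 0
  · rw [count_roots, h z hz, Multiset.one_le_count_iff_mem, mem_roots hf0]
    exact hf z hz
  · rw [Multiset.count_eq_zero_of_notMem fun hm => hz (isRoot_of_mem_roots hm)]
    exact Nat.zero_le _

/-! ### The space `U` and its stabilizer ring -/

section

variable {ℓ : ℕ} {lam : Fin ℓ → ℕ}

/-- `U` is the full range of `y ↦ Wr (H k₁, …, H k_ℓ, y)`: the Hermite polynomials span `ℂ[X]`,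
those of degree `k i` are annihilated, and positivity of the parts gives `ℓ ≤ N`, so that every other
degree `n` has the form `n' + ℓ - N` with `n'` in the degree set. -/
theorem mem_spaceU_iff (hpos : ∀ i, 0 < lam i) {p : ℂ[X]} :
    p ∈ spaceU lam ↔ ∃ y, wrSnoc (fun i => H (kseq lam i)) y = p := by
  let A : ℂ[X] →ₗ[ℂ] ℂ[X] :=
    { toFun := wrSnoc fun i => H (kseq lam i)
      map_add' := wrSnoc_add _
      map_smul' := wrSnoc_smul _ }
  suffices h : spaceU lam = LinearMap.range A by rw [h]; rfl
  have hsize : ℓ ≤ size lam := by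
    simpa [size] using Finset.card_nsmul_le_sum Finset.univ lam 1 fun i _ => hpos i
  rw [LinearMap.range_eq_map, ← span_range_H, Submodule.map_span, spaceU]
  refine le_antisymm (Submodule.span_mono ?_) (Submodule.span_le.2 ?_)
  · rintro _ ⟨n, -, rfl⟩
    exact ⟨_, ⟨_, rfl⟩, rfl⟩
  · rintro _ ⟨_, ⟨n, rfl⟩, rfl⟩
    by_cases hn : ∃ i, n = kseq lam i
    · obtain ⟨i, rfl⟩ := hn
      rw [show A (H (kseq lam i)) = 0 from wrSnoc_self (fun i => H (kseq lam i)) i]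
      exact Submodule.zero_mem _
    · have hsub : n + size lam - ℓ + ℓ - size lam = n := by omega
      refine Submodule.subset_span ⟨n + size lam - ℓ, ⟨by omega, fun i hi => hn ⟨i, ?_⟩⟩, ?_⟩
      · rw [← hi, hsub]
      · rw [exceptionalH, hsub]
        rfl

theorem mul_mem_spaceU_of_dvd (hpos : ∀ i, 0 < lam i) {f p : ℂ[X]}
    (hf : eta lam ∣ derivative f) (hp : p ∈ spaceU lam) : f * p ∈ spaceU lam := by
  obtain ⟨y, rfl⟩ := (mem_spaceU_iff hpos).1 hp
  exact (mem_spaceU_iff hpos).2 (mul_wrSnoc_mem_range hf y)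

theorem mem_spaceU_of_sq_dvd (hpos : ∀ i, 0 < lam i) {p : ℂ[X]} (hp : eta lam ^ 2 ∣ p) :
    p ∈ spaceU lam := by
  obtain ⟨q, rfl⟩ := hp
  exact (mem_spaceU_iff hpos).2 (sq_mul_mem_range _ q)

theorem eta_dvd_of_mem_spaceU (hpos : ∀ i, 0 < lam i) {p : ℂ[X]} (hp : p ∈ spaceU lam) :
    eta lam ∣ 2 * derivative (eta lam) * (X * p - derivative p) +
      derivative (derivative (eta lam)) * p := by
  obtain ⟨y, rfl⟩ := (mem_spaceU_iff hpos).1 hp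
  refine wr_dvd_of_mem_range (μ := fun i => -(2 * (kseq lam i : ℂ))) (fun k => ?_) y
  rw [hermiteOp, hermite_equation]
  simp [C_ofNat]

theorem exists_mem_spaceU_eval_ne_zero (hpos : ∀ i, 0 < lam i) (h : OnlySimpleRoots (eta lam))
    {z : ℂ} (hz : (eta lam).eval z = 0) :
    ∃ u ∈ spaceU lam, u.eval z ≠ 0 := by
  obtain ⟨y, hy⟩ := exists_wrSnoc_eval_ne_zero hz (h.eval_derivative_ne_zero hz)
  exact ⟨_, (mem_spaceU_iff hpos).2 ⟨y, rfl⟩, hy⟩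

theorem mem_stabilizerRing_iff {f : ℂ[X]} :
    f ∈ stabilizerRing lam ↔ ∀ p ∈ spaceU lam, f * p ∈ spaceU lam :=
  ⟨fun hf _ hp => mul_mem_spaceU hf hp, fun hf n hn => hf _ (Submodule.subset_span ⟨n, hn, rfl⟩)⟩

/-- Comparing the divisibility conditions for `u` and `f * u` shows that `η` divides
`2 * η' * f' * u` for every `u` in `U`, and at each zero of `η` some `u` does not vanish. -/
theorem eta_dvd_derivative_of_mem_stabilizerRing (hpos : ∀ i, 0 < lam i)
    (h : OnlySimpleRoots (eta lam)) {f : ℂ[X]} (hf : f ∈ stabilizerRing lam) :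
    eta lam ∣ derivative f := by
  refine h.dvd fun z hz => ?_
  obtain ⟨u, hu, huz⟩ := exists_mem_spaceU_eval_ne_zero hpos h hz
  obtain ⟨a, ha⟩ := eta_dvd_of_mem_spaceU hpos hu
  obtain ⟨b, hb⟩ := eta_dvd_of_mem_spaceU hpos (mem_stabilizerRing_iff.1 hf u hu)
  have key : 2 * derivative (eta lam) * derivative f * u = eta lam * (f * a - b) := by
    rw [derivative_mul] at hb
    linear_combination f * ha - hb
  have := congrArg (eval z) key
  simpa [hz, h.eval_derivative_ne_zero hz, huz] using this

/-- Polynomials `e i` with sum `1`, one for each zero `i` of `η`, localize the question: `e i` is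
divisible by `(X - j) ^ 2` for all zeros `j ≠ i`, and by the first part of the theorem it stabilizes
`U`. The product `e i * p` lies in `U` as soon as `p` agrees with a member of `U` to second order
at `i`, since `η ^ 2 * ℂ[X]` is contained in `U`. -/
theorem mem_spaceU_of_eta_dvd (hpos : ∀ i, 0 < lam i) (h : OnlySimpleRoots (eta lam)) {p : ℂ[X]}
    (hp : eta lam ∣ 2 * derivative (eta lam) * (X * p - derivative p) +
      derivative (derivative (eta lam)) * p) : p ∈ spaceU lam := by
  classical
  set t := (eta lam).roots.toFinset with ht
  have mem_t {z : ℂ} : z ∈ t ↔ (eta lam).eval z = 0 := by simp [ht, h.ne_zero]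
  rcases t.eq_empty_or_nonempty with hempty | hne
  · have h1 : eta lam ∣ 1 := h.dvd fun z hz => by simp [hempty] at mem_t; exact (mem_t hz).elim
    exact mem_spaceU_of_sq_dvd hpos (((pow_dvd_pow_of_dvd h1 2).trans (by simp)).trans (one_dvd p))
  have hcop : Pairwise (Function.onFun IsCoprime fun i : t => (X - C (i : ℂ)) ^ 2) :=
    fun i j hij => (isCoprime_X_sub_C_of_isUnit_sub
      (sub_ne_zero.2 (Subtype.coe_injective.ne hij)).isUnit).pow
  obtain ⟨μ, hμ⟩ := (exists_sum_eq_one_iff_pairwise_coprime hne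
    (s := fun z : ℂ => (X - C z) ^ 2)).2 hcop
  -- `∑ i ∈ t, e i = 1`, and modulo `eta lam ^ 2` the `e i` are the idempotents attached to the zeros
  set e : ℂ → ℂ[X] := fun i => μ i * ∏ j ∈ t \ {i}, (X - C j) ^ 2 with he
  have he_dvd {i j : ℂ} (hj : j ∈ t) (hij : j ≠ i) : (X - C j) ^ 2 ∣ e i :=
    (Finset.dvd_prod_of_mem (fun j => (X - C j) ^ 2) (by simp [hj, hij])).mul_left _
  have heval {z : ℂ} {q : ℂ[X]} (hq : (X - C z) ^ 2 ∣ q) : (derivative q).eval z = 0 := by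
    obtain ⟨r, rfl⟩ := hq
    simp [derivative_mul, derivative_pow]
  have he_deriv {i : ℂ} (hi : i ∈ t) : eta lam ∣ derivative (e i) := by
    refine h.dvd fun z hz => ?_
    by_cases hzi : z = i
    · subst hzi
      have h1 : e z = 1 - ∑ j ∈ t.erase z, e j := by
        rw [← hμ, ← Finset.add_sum_erase _ _ hi, add_sub_cancel_right]
      rw [h1, derivative_sub, derivative_one, zero_sub, eval_neg, neg_eq_zero]
      exact heval <| Finset.dvd_sum fun j hj => he_dvd hi (Finset.ne_of_mem_erase hj).symm
    · exact heval (he_dvd (mem_t.2 hz) hzi)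
  have hprod : eta lam ∣ ∏ j ∈ t, (X - C j) := h.dvd fun z hz => by
    rw [eval_prod]
    exact Finset.prod_eq_zero (mem_t.2 hz) (by simp)
  rw [← one_mul p, ← hμ, Finset.sum_mul]
  refine Submodule.sum_mem _ fun i hi => ?_
  have hiz := mem_t.1 hi
  obtain ⟨u, hu, hui⟩ := exists_mem_spaceU_eval_ne_zero hpos h hiz
  set c : ℂ := p.eval i / u.eval i with hc
  -- `p` and `c • u` take the same value at `i`, and the divisibility condition determines the
  -- derivative at `i` from the value
  have hsq : (X - C i) ^ 2 ∣ p - c • u := by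
    have h0 : (p - c • u).eval i = 0 := by simp [hc, hui]
    have h1 : (derivative (p - c • u)).eval i = 0 := by
      obtain ⟨a, ha⟩ := hp
      obtain ⟨b, hb⟩ := eta_dvd_of_mem_spaceU hpos ((spaceU lam).smul_mem c hu)
      have hab : 2 * derivative (eta lam) * derivative (p - c • u) =
          (2 * derivative (eta lam) * X + derivative (derivative (eta lam))) * (p - c • u) -
            eta lam * (a - b) := by
        rw [derivative_sub]
        linear_combination hb - ha
      generalize p - c • u = d at h0 hab ⊢
      simpa [h0, hiz, h.eval_derivative_ne_zero hiz] using congrArg (eval i) hab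
    by_cases hq : p - c • u = 0
    · simp [hq]
    · exact (le_rootMultiplicity_iff hq).1
        ((one_lt_rootMultiplicity_iff_isRoot hq).2 ⟨h0, h1⟩)
  have hsplit : e i * p = e i * (p - c • u) + c • (e i * u) := by
    rw [mul_sub, mul_smul_comm, sub_add_cancel]
  rw [show μ i * _ = e i from rfl, hsplit]
  refine Submodule.add_mem _ (mem_spaceU_of_sq_dvd hpos ?_)
    (Submodule.smul_mem _ _ (mul_mem_spaceU_of_dvd hpos (he_deriv hi) hu))
  refine (pow_dvd_pow_of_dvd hprod 2).trans ?_
  rw [← Finset.prod_pow, ← Finset.prod_sdiff (Finset.singleton_subset_iff.2 hi),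
    Finset.prod_singleton]
  exact mul_dvd_mul (dvd_mul_left _ _) hsq

end

end ExceptionalHermite

theorem proposition5 {ℓ : ℕ} (lam : Fin ℓ → ℕ) (hmono : Monotone lam) (hpos : ∀ i, 0 < lam i) :
    (∀ f : ℂ[X], ExceptionalHermite.eta lam ∣ derivative f →
      f ∈ ExceptionalHermite.stabilizerRing lam) ∧
    (ExceptionalHermite.OnlySimpleRoots (ExceptionalHermite.eta lam) →
      ∀ f ∈ ExceptionalHermite.stabilizerRing lam,
        ExceptionalHermite.eta lam ∣ derivative f) ∧
    (∀ p ∈ ExceptionalHermite.spaceU lam,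
      ExceptionalHermite.eta lam ∣
        2 * derivative (ExceptionalHermite.eta lam) * (X * p - derivative p) +
          derivative (derivative (ExceptionalHermite.eta lam)) * p) ∧
    (ExceptionalHermite.OnlySimpleRoots (ExceptionalHermite.eta lam) →
      ∀ p : ℂ[X], p ∈ ExceptionalHermite.spaceU lam ↔
        ExceptionalHermite.eta lam ∣
          2 * derivative (ExceptionalHermite.eta lam) * (X * p - derivative p) +
            derivative (derivative (ExceptionalHermite.eta lam)) * p) := by
  open ExceptionalHermite in
  exact ⟨fun f hf => mem_stabilizerRing_iff.2 fun p hp => mul_mem_spaceU_of_dvd hpos hf hp,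
    fun h f hf => eta_dvd_derivative_of_mem_stabilizerRing hpos h hf,
    fun p hp => eta_dvd_of_mem_spaceU hpos hp,
    fun h p => ⟨eta_dvd_of_mem_spaceU hpos, mem_spaceU_of_eta_dvd hpos h⟩⟩
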